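/- Work in continuous first-order logic for metric structures. A signature $\mathcal L$ consists of function symbols (including constants) and predicate symbols, a bound on the diameter of structures, a closed bounded real interval $I_P$ for every predicate symbol $P$, and a modulus of uniform continuity for every symbol; an $\mathcal L$-structure is a nonempty complete metric space obeying the diameter bound, with interpretations of the symbols obeying the moduli and with $P$ taking values in $I_P$. Formulas are built from the atomic formulas $d(t,s)$ and $P(t_1,\ldots,t_m)$ by continuous connectives and the quantifiers $\sup_x$, $\inf_x$. Each formula has an associated closed bounded interval of values: $[0,D]$ for $d(t,s)$, where $D$ is the diameter bound, $I_P$ for $P(t_1,\ldots,t_m)$, the prescribed interval of values of the outermost connective for a compound formula, and the interval of $\varphi$ for $\sup_x\varphi$ and $\inf_x\varphi$. A theory is a set of closed conditions "$\sigma=0$" with $\sigma$ an $\mathcal L$-sentence. An $\mathcal L$-theory $T$ is *primitive* if there are a set $\Gamma$ of universal conditions (of the form $\sup_{\vec x}\varphi(\vec x)=0$) and a set $\Delta$ of existential conditions (of the form $\inf_{\vec x}\varphi(\vec x)=0$), with each $\varphi$ quantifier-free with associated interval contained in $[0,\infty)$, such that $\Gamma\cup\Delta$ and $T$ have the same models.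 $T$ *admits quantifier elimination* if for every $n\ge 1$, every $\mathcal L$-formula $\varphi(x_1,\ldots,x_n)$ and every $\epsilon>0$ there is a quantifier-free $\mathcal L$-formula $\psi(x_1,\ldots,x_n)$ such that $|\varphi^{\mathcal N}(\vec a)-\psi^{\mathcal N}(\vec a)|\le\epsilon$ for all $\mathcal N\models T$ and all $\vec a\in N^n$. For an $\mathcal L$-structure $\mathcal M$, $\mathcal L(M)$ is $\mathcal L$ together with constants naming the elements of $M$. A function $f:M^n\to M$ is *definable* if the predicate $(\vec x,y)\mapsto d(f(\vec x),y)$ on $M^{n+1}$ is a uniform limit of interpretations in $\mathcal M$ of $\mathcal L(M)$-formulas. **Proposition.** Suppose that $T$ is a primitive $\mathcal L$-theory that admits quantifier elimination, $\mathcal M\models T$, and $f:M^n\to M$ is a definable function. Then for every $\epsilon>0$ there are finitely many $\mathcal L(M)$-terms $t_1(\vec x),\ldots,t_k(\vec x)$ such that for all $\vec a\in M^n$ there is $i\in\{1,\ldots,k\}$ with $d(f(\vec a),t_i(\vec a))\le\epsilon$. -/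

import Mathlib

universe u v w w'

namespace ContinuousLogic

/-- A (one-sorted) signature of continuous logic: function symbols and predicate symbols of each
arity, a bound `diam` on the diameter of structures, a closed bounded interval `[lo R, hi R]` of
values for each predicate symbol `R`, and a modulus of uniform continuity for each symbol.
Constant symbols are the function symbols of arity `0`. -/
structure Signature where
  Func : ℕ → Type u
  Rel : ℕ → Type v
  diam : ℝ
  diam_nonneg : 0 ≤ diam
  lo : ∀ {n : ℕ}, Rel n → ℝ
  hi : ∀ {n : ℕ}, Rel n → ℝ
  lo_le_hi : ∀ {n : ℕ} (R : Rel n), lo R ≤ hi R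
  funcModulus : ∀ {n : ℕ}, Func n → ℝ → ℝ
  funcModulus_pos : ∀ {n : ℕ} (f : Func n) (ε : ℝ), 0 < ε → 0 < funcModulus f ε
  relModulus : ∀ {n : ℕ}, Rel n → ℝ → ℝ
  relModulus_pos : ∀ {n : ℕ} (R : Rel n) (ε : ℝ), 0 < ε → 0 < relModulus R ε

/-- An `L`-structure (metric structure): a nonempty complete metric space of diameter at most
`L.diam`, with interpretations of the symbols that obey the prescribed moduli of uniform continuity
and ranges. The distance on `Fin n → M` is the maximum of the coordinatewise distances. -/
class MetricStructure (L : Signature.{u, v}) (M : Type w) [MetricSpace M] where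
  complete : CompleteSpace M
  nonempty : Nonempty M
  dist_le_diam : ∀ a b : M, dist a b ≤ L.diam
  funMap : ∀ {n : ℕ}, L.Func n → (Fin n → M) → M
  relMap : ∀ {n : ℕ}, L.Rel n → (Fin n → M) → ℝ
  relMap_mem : ∀ {n : ℕ} (R : L.Rel n) (a : Fin n → M), relMap R a ∈ Set.Icc (L.lo R) (L.hi R)
  funMap_modulus : ∀ {n : ℕ} (f : L.Func n) (ε : ℝ), 0 < ε → ∀ a b : Fin n → M,
    dist a b < L.funcModulus f ε → dist (funMap f a) (funMap f b) ≤ ε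
  relMap_modulus : ∀ {n : ℕ} (R : L.Rel n) (ε : ℝ), 0 < ε → ∀ a b : Fin n → M,
    dist a b < L.relModulus R ε → |relMap R a - relMap R b| ≤ ε

/-- `L`-terms with variables from `α`. -/
inductive Term (L : Signature.{u, v}) (α : Type w) : Type (max u w)
  | var : α → Term L α
  | func : ∀ {k : ℕ}, L.Func k → (Fin k → Term L α) → Term L α

/-- `L`-formulas whose free variables are among the variables in `α` together with `n` further
variables indexed by `Fin n`; a quantifier binds the last of these.

The connectives are the continuous functions with values in a closed bounded interval `[a, b]`.
They are taken to be defined on all of `ℝᵏ`; as every continuous function from a product of `k`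
closed bounded intervals to `[a, b]` extends to `ℝᵏ` (Tietze), this yields all connectives. -/
inductive Formula (L : Signature.{u, v}) (α : Type w) : ℕ → Type (max u v w)
  | dist : ∀ {n : ℕ}, Term L (α ⊕ Fin n) → Term L (α ⊕ Fin n) → Formula L α n
  | rel : ∀ {n k : ℕ}, L.Rel k → (Fin k → Term L (α ⊕ Fin n)) → Formula L α n
  | conn : ∀ {n k : ℕ} {a b : ℝ}, C(Fin k → ℝ, Set.Icc a b) → (Fin k → Formula L α n) →
      Formula L α n
  | sup : ∀ {n : ℕ}, Formula L α (n + 1) → Formula L α n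
  | inf : ∀ {n : ℕ}, Formula L α (n + 1) → Formula L α n

/-- Sentences: formulas without free variables. A sentence `σ` also stands for the closed
condition `σ = 0`. -/
abbrev Sentence (L : Signature.{u, v}) : Type (max u v) := Formula L Empty 0

/-- The value of a term. -/
def Term.realize {L : Signature.{u, v}} {α : Type w'} {M : Type w} [MetricSpace M]
    [MetricStructure L M] (val : α → M) : Term L α → M
  | .var x => val x
  | .func f ts => MetricStructure.funMap f (fun i => (ts i).realize val)

/-- The value of a formula. -/
noncomputable def Formula.realize {L : Signature.{u, v}} {α : Type w'} {M : Type w} [MetricSpace M]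
    [MetricStructure L M] (val : α → M) : ∀ {n : ℕ}, Formula L α n → (Fin n → M) → ℝ
  | _, .dist t s, x => Dist.dist (t.realize (Sum.elim val x)) (s.realize (Sum.elim val x))
  | _, .rel R ts, x => MetricStructure.relMap R (fun i => (ts i).realize (Sum.elim val x))
  | _, .conn c φ, x => (c (fun i => (φ i).realize val x) : ℝ)
  | _, .sup φ, x => ⨆ y : M, φ.realize val (Fin.snoc x y : Fin (_ + 1) → M)
  | _, .inf φ, x => ⨅ y : M, φ.realize val (Fin.snoc x y : Fin (_ + 1) → M)

/-- The closed bounded interval of values associated with a formula. -/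
def Formula.range {L : Signature.{u, v}} {α : Type w} : ∀ {n : ℕ}, Formula L α n → Set ℝ
  | _, .dist _ _ => Set.Icc 0 L.diam
  | _, .rel R _ => Set.Icc (L.lo R) (L.hi R)
  | _, .conn (a := a) (b := b) _ _ => Set.Icc a b
  | _, .sup φ => φ.range
  | _, .inf φ => φ.range

/-- Quantifier-free formulas. -/
def Formula.IsQF {L : Signature.{u, v}} {α : Type w} : ∀ {n : ℕ}, Formula L α n → Prop
  | _, .dist _ _ => True
  | _, .rel _ _ => True
  | _, .conn _ φ => ∀ i, (φ i).IsQF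
  | _, .sup _ => False
  | _, .inf _ => False

/-- `sup` over all the variables indexed by `Fin n`. -/
def Formula.sups {L : Signature.{u, v}} {α : Type w} : ∀ {n : ℕ}, Formula L α n → Formula L α 0
  | 0, φ => φ
  | _ + 1, φ => φ.sup.sups

/-- `inf` over all the variables indexed by `Fin n`. -/
def Formula.infs {L : Signature.{u, v}} {α : Type w} : ∀ {n : ℕ}, Formula L α n → Formula L α 0
  | 0, φ => φ
  | _ + 1, φ => φ.inf.infs

/-- The condition `σ = 0` is universal: `σ` is `sup_x φ(x)` for a quantifier-free formula `φ(x)`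
with values in an interval contained in `[0, ∞)`. -/
def IsUniversal {L : Signature.{u, v}} (σ : Sentence L) : Prop :=
  ∃ (n : ℕ) (φ : Formula L Empty n), φ.IsQF ∧ φ.range ⊆ Set.Ici 0 ∧ σ = φ.sups

/-- The condition `σ = 0` is existential: `σ` is `inf_x φ(x)` for a quantifier-free formula `φ(x)`
with values in an interval contained in `[0, ∞)`. -/
def IsExistential {L : Signature.{u, v}} (σ : Sentence L) : Prop :=
  ∃ (n : ℕ) (φ : Formula L Empty n), φ.IsQF ∧ φ.range ⊆ Set.Ici 0 ∧ σ = φ.infs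

/-- A theory: a set of closed conditions `σ = 0`. -/
abbrev Theory (L : Signature.{u, v}) : Type (max u v) := Set (Sentence L)

/-- `M` is a model of `T`. -/
def Models {L : Signature.{u, v}} (M : Type w) [MetricSpace M] [MetricStructure L M]
    (T : Theory L) : Prop :=
  ∀ σ ∈ T, Formula.realize (M := M) Empty.elim σ Fin.elim0 = 0

/-- `A` axiomatizes `T`: they have the same models (of size bounded by the universe
`max u v w`, which contains the universes of the signature; by the downward Löwenheim-Skolem theorem
the value of `w` is immaterial). -/
def Axiomatizes {L : Signature.{u, v}} (A T : Theory L) : Prop :=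
  ∀ (M : Type (max u v w)) [MetricSpace M] [MetricStructure L M], Models M A ↔ Models M T

/-- `T` is primitive: axiomatized by universal together with existential conditions. -/
def IsPrimitive {L : Signature.{u, v}} (T : Theory L) : Prop :=
  ∃ Γ Δ : Theory L, (∀ σ ∈ Γ, IsUniversal σ) ∧ (∀ σ ∈ Δ, IsExistential σ) ∧
    Axiomatizes.{u, v, w} (Γ ∪ Δ) T

/-- `T` admits quantifier elimination: every formula `φ(x₁, …, xₙ)` can be approximated by
quantifier-free formulas in the same variables, uniformly in all models of `T`. As usual, sentences
are regarded as formulas in a dummy variable, so only `n ≥ 1` is considered. -/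
def HasQE {L : Signature.{u, v}} (T : Theory L) : Prop :=
  ∀ (n : ℕ), 1 ≤ n → ∀ (φ : Formula L (Fin n) 0) (ε : ℝ), 0 < ε →
    ∃ ψ : Formula L (Fin n) 0, ψ.IsQF ∧
      ∀ (M : Type (max u v w)) [MetricSpace M] [MetricStructure L M], Models M T →
        ∀ a : Fin n → M, |φ.realize a Fin.elim0 - ψ.realize a Fin.elim0| ≤ ε

/-- `L(M)`-terms `t(x₁, …, xₙ)`: terms built from the variables `x₁, …, xₙ` and constants for the
elements of `M`. -/
abbrev TermWithParams (L : Signature.{u, v}) (M : Type w) (n : ℕ) : Type (max u w) :=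
  Term L (M ⊕ Fin n)

/-- `L(M)`-formulas `φ(x₁, …, xₙ)`: formulas built from the variables `x₁, …, xₙ` and constants for
the elements of `M`. -/
abbrev FormulaWithParams (L : Signature.{u, v}) (M : Type w) (n : ℕ) : Type (max u v w) :=
  Formula L (M ⊕ Fin n) 0

/-- The value of an `L(M)`-term at a tuple; the constant for `c ∈ M` denotes `c`. -/
def TermWithParams.eval {L : Signature.{u, v}} {M : Type w} [MetricSpace M] [MetricStructure L M]
    {n : ℕ} (t : TermWithParams L M n) (a : Fin n → M) : M :=
  Term.realize (Sum.elim id a) t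

/-- The value of an `L(M)`-formula at a tuple; the constant for `c ∈ M` denotes `c`. -/
noncomputable def FormulaWithParams.eval {L : Signature.{u, v}} {M : Type w} [MetricSpace M]
    [MetricStructure L M] {n : ℕ} (φ : FormulaWithParams L M n) (a : Fin n → M) : ℝ :=
  Formula.realize (Sum.elim id a) φ Fin.elim0

/-- `P : Mⁿ → ℝ` is a definable predicate (with parameters from `M`): it is a uniform limit of
interpretations of `L(M)`-formulas. -/
def DefinablePredicate (L : Signature.{u, v}) {M : Type w} [MetricSpace M] [MetricStructure L M]
    {n : ℕ} (P : (Fin n → M) → ℝ) : Prop :=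
  ∀ ε : ℝ, 0 < ε → ∃ φ : FormulaWithParams L M n, ∀ a : Fin n → M,
    |FormulaWithParams.eval φ a - P a| ≤ ε

/-- `f : Mⁿ → M` is a definable function (with parameters from `M`): the predicate
`(x, y) ↦ d(f(x), y)` on `Mⁿ⁺¹` is definable. -/
def DefinableFunction (L : Signature.{u, v}) {M : Type w} [MetricSpace M] [MetricStructure L M]
    {n : ℕ} (f : (Fin n → M) → M) : Prop :=
  DefinablePredicate L (fun z : Fin (n + 1) → M => dist (f (fun i => z i.castSucc)) (z (Fin.last n)))

end ContinuousLogic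

/-! Suppose that no finite set of terms works for `ε`. Each finite set `F` of `L(M)`-terms then has
a tuple `a F` at which `f` is farther than `ε` from all terms in `F`. Along an ultrafilter on the
finite sets of terms, every single term stays farther than `ε` from `f` at almost all `a F`.

Let `N` be the closure, in the ultrapower of `M`, of the values of `L(M)`-terms at the class of this
family. Universal conditions pass from `M` to its ultrapower and down to `N`; existential ones pass
up from the diagonal copy of `M` in `N`. As `T` is primitive, `N` is a model of `T`
(`IsPrimitive.models_termModel`).

Let `φ(x, y)` approximate `d(f(x), y)`. In `M`, `inf_y φ` is small at every tuple. Quantifier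
elimination, valid in both `M` and `N`, carries this to `N`, so some `y` in `N` makes `φ` small.
Terms are dense in `N`, so `y` may be taken to be a term, and a quantifier-free approximation of `φ`
carries the estimate back to almost all `a F` (`DefinableFunction.exists_term`), a contradiction.

The ultrapower is never built: `N` is the completion of the terms under the limit pseudometric, and
only a quantifier-free Łoś theorem (`TermModel.tendsto_realize`) is needed. -/

open Filter Topology

namespace ContinuousLogic

variable {L : Signature.{u, v}}

/-! ### Continuity of terms and quantifier-free formulas -/

section Continuity

variable {M : Type w} [MetricSpace M] [MetricStructure L M]

theorem continuous_of_modulus {X Y : Type*} [PseudoMetricSpace X] [PseudoMetricSpace Y]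
    {g : X → Y} {δ : ℝ → ℝ} (hδ : ∀ ε, 0 < ε → 0 < δ ε)
    (hg : ∀ ε, 0 < ε → ∀ a b, dist a b < δ ε → dist (g a) (g b) ≤ ε) : UniformContinuous g := by
  rw [Metric.uniformContinuous_iff]
  intro ε hε
  refine ⟨δ (ε / 2), hδ _ (half_pos hε), fun a b hab => ?_⟩
  exact (hg _ (half_pos hε) _ _ hab).trans_lt (half_lt_self hε)

theorem continuous_funMap {k : ℕ} (f : L.Func k) :
    Continuous (MetricStructure.funMap (M := M) f) :=
  (continuous_of_modulus (L.funcModulus_pos f) (MetricStructure.funMap_modulus f)).continuous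

theorem continuous_relMap {k : ℕ} (R : L.Rel k) :
    Continuous (MetricStructure.relMap (M := M) R) :=
  (continuous_of_modulus (L.relModulus_pos R) (MetricStructure.relMap_modulus R)).continuous

theorem Term.continuous_realize {α : Type w'} (t : Term L α) :
    Continuous fun val : α → M => t.realize val := by
  induction t with
  | var x => exact continuous_apply x
  | func f ts ih => exact (continuous_funMap f).comp (continuous_pi ih)

theorem continuous_sumElim {α : Type*} {β : Type*} {X : Type*} [TopologicalSpace X] :
    Continuous fun p : (α → X) × (β → X) => (Sum.elim p.1 p.2 : α ⊕ β → X) := by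
  refine continuous_pi fun i => ?_
  cases i <;> simp only [Sum.elim_inl, Sum.elim_inr] <;> fun_prop

theorem Formula.IsQF.continuous_realize {α : Type w'} {n : ℕ} {φ : Formula L α n}
    (hφ : φ.IsQF) :
    Continuous fun p : (α → M) × (Fin n → M) => φ.realize p.1 p.2 := by
  induction φ with
  | dist t s =>
    exact ((t.continuous_realize).comp continuous_sumElim).dist
      ((s.continuous_realize).comp continuous_sumElim)
  | rel R ts =>
    exact (continuous_relMap R).comp
      (continuous_pi fun i => ((ts i).continuous_realize).comp continuous_sumElim)
  | conn c φ ih =>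
    exact continuous_subtype_val.comp (c.continuous.comp (continuous_pi fun i => ih i (hφ i)))
  | sup φ => exact hφ.elim
  | inf φ => exact hφ.elim

end Continuity

/-! ### Bounds on values; universal and existential conditions -/

section Range

variable {M : Type w} [MetricSpace M] [MetricStructure L M] {α : Type w'}

theorem Formula.exists_range_eq_Icc {n : ℕ} (φ : Formula L α n) :
    ∃ a b : ℝ, φ.range = Set.Icc a b := by
  induction φ with
  | dist t s => exact ⟨_, _, rfl⟩
  | rel R ts => exact ⟨_, _, rfl⟩
  | conn c φ => exact ⟨_, _, rfl⟩
  | sup φ ih => exact ih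
  | inf φ ih => exact ih

theorem Formula.realize_mem_range {n : ℕ} (φ : Formula L α n) (val : α → M) (x : Fin n → M) :
    φ.realize val x ∈ φ.range := by
  have : Nonempty M := MetricStructure.nonempty L
  induction φ with
  | dist t s => exact ⟨dist_nonneg, MetricStructure.dist_le_diam _ _⟩
  | rel R ts => exact MetricStructure.relMap_mem R _
  | conn c φ => exact Subtype.prop _
  | sup φ ih =>
    obtain ⟨a, b, hab⟩ := φ.exists_range_eq_Icc
    simp only [hab, Formula.range, Formula.realize] at ih ⊢
    exact ⟨le_ciSup_of_le ⟨b, by rintro _ ⟨y, rfl⟩; exact (ih _).2⟩ (Classical.arbitrary M) (ih _).1,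
      ciSup_le fun y => (ih _).2⟩
  | inf φ ih =>
    obtain ⟨a, b, hab⟩ := φ.exists_range_eq_Icc
    simp only [hab, Formula.range, Formula.realize] at ih ⊢
    exact ⟨le_ciInf fun y => (ih _).1,
      ciInf_le_of_le ⟨a, by rintro _ ⟨y, rfl⟩; exact (ih _).1⟩ (Classical.arbitrary M) (ih _).2⟩

/-- An unbounded real supremum or infimum has the default value `0`; these bounds ensure that
quantifiers have their intended meaning. -/
theorem Formula.exists_bounds {n : ℕ} (φ : Formula L α n) :
    ∃ a b : ℝ, ∀ (val : α → M) (x : Fin n → M), φ.realize val x ∈ Set.Icc a b := by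
  obtain ⟨a, b, hab⟩ := φ.exists_range_eq_Icc
  exact ⟨a, b, fun val x => hab ▸ φ.realize_mem_range val x⟩

theorem Formula.realize_sup_le_iff {n : ℕ} (φ : Formula L α (n + 1)) (val : α → M)
    (x : Fin n → M) (r : ℝ) :
    φ.sup.realize val x ≤ r ↔ ∀ y : M, φ.realize val (Fin.snoc x y : Fin (n + 1) → M) ≤ r := by
  have : Nonempty M := MetricStructure.nonempty L
  obtain ⟨a, b, hab⟩ := φ.exists_bounds (M := M)
  exact ciSup_le_iff ⟨b, by rintro _ ⟨y, rfl⟩; exact (hab _ _).2⟩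

theorem Formula.realize_inf_lt_iff {n : ℕ} (φ : Formula L α (n + 1)) (val : α → M)
    (x : Fin n → M) (r : ℝ) :
    φ.inf.realize val x < r ↔ ∃ y : M, φ.realize val (Fin.snoc x y : Fin (n + 1) → M) < r := by
  have : Nonempty M := MetricStructure.nonempty L
  obtain ⟨a, b, hab⟩ := φ.exists_bounds (M := M)
  exact ciInf_lt_iff ⟨a, by rintro _ ⟨y, rfl⟩; exact (hab _ _).1⟩

theorem Formula.realize_sups_le_iff {n : ℕ} (φ : Formula L α n) (val : α → M) (r : ℝ) :
    φ.sups.realize val Fin.elim0 ≤ r ↔ ∀ x : Fin n → M, φ.realize val x ≤ r := by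
  induction n with
  | zero => exact ⟨fun h x => by rwa [Subsingleton.elim x Fin.elim0], fun h => h _⟩
  | succ n ih =>
    refine (ih φ.sup).trans ⟨fun h x => ?_, fun h x => ?_⟩
    · have := (φ.realize_sup_le_iff val _ r).1 (h (Fin.init x)) (x (Fin.last n))
      rwa [Fin.snoc_init_self] at this
    · exact (φ.realize_sup_le_iff val _ r).2 fun y => h _

theorem Formula.realize_infs_lt_iff {n : ℕ} (φ : Formula L α n) (val : α → M) (r : ℝ) :
    φ.infs.realize val Fin.elim0 < r ↔ ∃ x : Fin n → M, φ.realize val x < r := by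
  induction n with
  | zero => exact ⟨fun h => ⟨_, h⟩, fun ⟨x, h⟩ => by rwa [Subsingleton.elim x Fin.elim0] at h⟩
  | succ n ih =>
    refine (ih φ.inf).trans ⟨fun ⟨x, h⟩ => ?_, fun ⟨x, h⟩ => ⟨Fin.init x, ?_⟩⟩
    · obtain ⟨y, hy⟩ := (φ.realize_inf_lt_iff val _ r).1 h
      exact ⟨_, hy⟩
    · refine (φ.realize_inf_lt_iff val _ r).2 ⟨x (Fin.last n), ?_⟩
      rwa [Fin.snoc_init_self]

theorem Formula.range_sups {n : ℕ} (φ : Formula L α n) : φ.sups.range = φ.range := by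
  induction n with
  | zero => rfl
  | succ n ih => exact ih φ.sup

theorem Formula.range_infs {n : ℕ} (φ : Formula L α n) : φ.infs.range = φ.range := by
  induction n with
  | zero => rfl
  | succ n ih => exact ih φ.inf

theorem Formula.realize_sups_eq_zero_iff {n : ℕ} {φ : Formula L α n}
    (hφ : φ.range ⊆ Set.Ici 0) (val : α → M) :
    φ.sups.realize val Fin.elim0 = 0 ↔ ∀ x : Fin n → M, φ.realize val x ≤ 0 := by
  rw [← φ.realize_sups_le_iff]
  refine ⟨le_of_eq, fun h => le_antisymm h (hφ ?_)⟩
  rw [← φ.range_sups]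
  exact φ.sups.realize_mem_range _ _

/-- The infimum need not be attained, so only approximate witnesses are available. -/
theorem Formula.realize_infs_eq_zero_iff {n : ℕ} {φ : Formula L α n}
    (hφ : φ.range ⊆ Set.Ici 0) (val : α → M) :
    φ.infs.realize val Fin.elim0 = 0 ↔
      ∀ r : ℝ, 0 < r → ∃ x : Fin n → M, φ.realize val x < r := by
  simp only [← φ.realize_infs_lt_iff]
  refine ⟨fun h r hr => by rwa [h], fun h => le_antisymm (le_of_forall_pos_lt_add ?_) (hφ ?_)⟩
  · simpa using h
  · rw [← φ.range_infs]
    exact φ.infs.realize_mem_range _ _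

end Range

/-! ### Renaming variables and finite support -/

section Relabel

variable {α : Type*} {β : Type*}

/-- Simultaneous substitution of terms for variables. -/
def Term.subst (g : α → Term L β) : Term L α → Term L β
  | .var x => g x
  | .func f ts => .func f fun i => (ts i).subst g

theorem Term.realize_subst {M : Type w} [MetricSpace M] [MetricStructure L M] (g : α → Term L β)
    (val : β → M) (t : Term L α) :
    (t.subst g).realize val = t.realize fun x => (g x).realize val := by
  induction t with
  | var x => rfl
  | func f ts ih => simp only [Term.subst, Term.realize, ih]

theorem Term.realize_subst_var {M : Type w} [MetricSpace M] [MetricStructure L M] {g : α → β}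
    {val : α → M} {val' : β → M} (h : ∀ i, val' (g i) = val i) (t : Term L α) :
    (t.subst (.var ∘ g)).realize val' = t.realize val := by
  rw [Term.realize_subst]
  exact congrArg (fun v => t.realize v) (funext h)

/-- Extends a map of variables to one more bound variable. -/
def liftVar {n m : ℕ} (g : α ⊕ Fin n → β ⊕ Fin m) : α ⊕ Fin (n + 1) → β ⊕ Fin (m + 1) :=
  Sum.elim (fun a => (g (.inl a)).map id Fin.castSucc)
    (Fin.snoc (fun i => (g (.inr i)).map id Fin.castSucc) (.inr (Fin.last m)))

theorem sumElim_snoc_liftVar {M : Type*} {n m : ℕ} {g : α ⊕ Fin n → β ⊕ Fin m}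
    {val : α → M} {x : Fin n → M} {val' : β → M} {x' : Fin m → M}
    (h : ∀ i, Sum.elim val' x' (g i) = Sum.elim val x i) (y : M) (i : α ⊕ Fin (n + 1)) :
    Sum.elim val' (Fin.snoc x' y : Fin (m + 1) → M) (liftVar g i) =
      Sum.elim val (Fin.snoc x y : Fin (n + 1) → M) i := by
  have key : ∀ z : β ⊕ Fin m, Sum.elim val' (Fin.snoc x' y : Fin (m + 1) → M)
      (z.map id Fin.castSucc) = Sum.elim val' x' z := by
    rintro (z | z) <;> simp
  rcases i with a | i
  · simpa [liftVar] using (key _).trans (h (.inl a))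
  · induction i using Fin.lastCases with
    | last => simp [liftVar]
    | cast i => simpa [liftVar] using (key _).trans (h (.inr i))

/-- Renames the variables of a formula. -/
def Formula.relabel : ∀ {n m : ℕ}, (α ⊕ Fin n → β ⊕ Fin m) → Formula L α n → Formula L β m
  | _, _, g, .dist t s => .dist (t.subst (.var ∘ g)) (s.subst (.var ∘ g))
  | _, _, g, .rel R ts => .rel R fun i => (ts i).subst (.var ∘ g)
  | _, _, g, .conn c φ => .conn c fun i => (φ i).relabel g
  | _, _, g, .sup φ => .sup (φ.relabel (liftVar g))
  | _, _, g, .inf φ => .inf (φ.relabel (liftVar g))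

theorem Formula.IsQF.relabel {n m : ℕ} {g : α ⊕ Fin n → β ⊕ Fin m} {φ : Formula L α n}
    (hφ : φ.IsQF) : (φ.relabel g).IsQF := by
  induction φ with
  | dist t s => trivial
  | rel R ts => trivial
  | conn c φ ih => exact fun i => ih i (hφ i)
  | sup φ => exact hφ.elim
  | inf φ => exact hφ.elim

theorem Formula.realize_relabel {M : Type w} [MetricSpace M] [MetricStructure L M] {n m : ℕ}
    {g : α ⊕ Fin n → β ⊕ Fin m} (φ : Formula L α n) {val : α → M} {x : Fin n → M}
    {val' : β → M} {x' : Fin m → M} (h : ∀ i, Sum.elim val' x' (g i) = Sum.elim val x i) :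
    (φ.relabel g).realize val' x' = φ.realize val x := by
  induction φ generalizing m with
  | dist t s => simp only [Formula.relabel, Formula.realize, Term.realize_subst_var h]
  | rel R ts => simp only [Formula.relabel, Formula.realize, Term.realize_subst_var h]
  | conn c φ ih => simp only [Formula.relabel, Formula.realize, fun i => ih i h]
  | sup φ ih => exact iSup_congr fun y => ih (sumElim_snoc_liftVar h y)
  | inf φ ih => exact iInf_congr fun y => ih (sumElim_snoc_liftVar h y)

theorem Term.exists_finite_support (t : Term L α) :
    ∃ s : Set α, s.Finite ∧ ∀ (M : Type w) [MetricSpace M] [MetricStructure L M]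
      (val val' : α → M), Set.EqOn val val' s → t.realize val = t.realize val' := by
  induction t with
  | var x => exact ⟨{x}, Set.finite_singleton x, fun M _ _ val val' h => h rfl⟩
  | func f ts ih =>
    choose s hs h using ih
    refine ⟨⋃ i, s i, Set.finite_iUnion hs, fun M _ _ val val' hv => ?_⟩
    simp only [Term.realize]
    exact congrArg _ (funext fun i => h i M val val' (hv.mono (Set.subset_iUnion s i)))

/-- The support is chosen before the structure, so one finite set of variables serves all models at
once. -/
theorem Formula.exists_finite_support {n : ℕ} (φ : Formula L α n) :
    ∃ s : Set α, s.Finite ∧ ∀ (M : Type w) [MetricSpace M] [MetricStructure L M]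
      (val val' : α → M) (x : Fin n → M), Set.EqOn val val' s →
        φ.realize val x = φ.realize val' x := by
  have ht : ∀ {k : ℕ} (t : Term L (α ⊕ Fin k)), ∃ s : Set α, s.Finite ∧
      ∀ (M : Type w) [MetricSpace M] [MetricStructure L M] (val val' : α → M) (x : Fin k → M),
        Set.EqOn val val' s → t.realize (Sum.elim val x) = t.realize (Sum.elim val' x) := by
    intro k t
    obtain ⟨s, hs, h⟩ := t.exists_finite_support
    refine ⟨Sum.inl ⁻¹' s, hs.preimage Sum.inl_injective.injOn, fun M _ _ val val' x hv => ?_⟩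
    refine h M _ _ ?_
    rintro (a | i) hi
    · exact hv hi
    · rfl
  induction φ with
  | dist t s =>
    obtain ⟨a, ha, h⟩ := ht t
    obtain ⟨b, hb, h'⟩ := ht s
    refine ⟨a ∪ b, ha.union hb, fun M _ _ val val' x hv => ?_⟩
    simp only [Formula.realize]
    rw [h M val val' x (hv.mono Set.subset_union_left),
      h' M val val' x (hv.mono Set.subset_union_right)]
  | rel R ts =>
    choose s hs h using fun i => ht (ts i)
    refine ⟨⋃ i, s i, Set.finite_iUnion hs, fun M _ _ val val' x hv => ?_⟩
    simp only [Formula.realize]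
    exact congrArg _ (funext fun i => h i M val val' x (hv.mono (Set.subset_iUnion s i)))
  | conn c φ ih =>
    choose s hs h using ih
    refine ⟨⋃ i, s i, Set.finite_iUnion hs, fun M _ _ val val' x hv => ?_⟩
    simp only [Formula.realize, fun i => h i M val val' x (hv.mono (Set.subset_iUnion s i))]
  | sup φ ih =>
    obtain ⟨s, hs, h⟩ := ih
    exact ⟨s, hs, fun M _ _ val val' x hv => iSup_congr fun y => h M val val' _ hv⟩
  | inf φ ih =>
    obtain ⟨s, hs, h⟩ := ih
    exact ⟨s, hs, fun M _ _ val val' x hv => iInf_congr fun y => h M val val' _ hv⟩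

/-- Quantifier elimination for formulas with an arbitrary nonempty type of variables. -/
theorem HasQE.exists_isQF {T : Theory L} (hT : HasQE.{u, v, w} T) [Nonempty α]
    (φ : Formula L α 0) {ε : ℝ} (hε : 0 < ε) :
    ∃ ψ : Formula L α 0, ψ.IsQF ∧
      ∀ (M : Type (max u v w)) [MetricSpace M] [MetricStructure L M], Models M T →
        ∀ val : α → M, |φ.realize val Fin.elim0 - ψ.realize val Fin.elim0| ≤ ε := by
  classical
  obtain ⟨s, hs, h⟩ := φ.exists_finite_support
  -- The extra element makes `F` nonempty, since quantifier elimination is assumed only for at least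
  -- one variable.
  let F : Finset α := insert (Classical.arbitrary α) hs.toFinset
  let e := F.equivFin
  have hF : 0 < F.card := Finset.card_pos.2 (Finset.insert_nonempty _ _)
  -- Variables outside `F` go to index `0`; the value of `φ` does not depend on them.
  let g : α → Fin F.card := fun a => if ha : a ∈ F then e ⟨a, ha⟩ else ⟨0, hF⟩
  let j : Fin F.card → α := fun i => e.symm i
  have hjg : ∀ a ∈ s, j (g a) = a := by
    intro a ha
    have : a ∈ F := by simp [F, ha]
    simp [j, g, this]
  obtain ⟨ψ, hψ, hφψ⟩ := hT F.card hF (φ.relabel (Sum.map g id)) ε hε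
  refine ⟨ψ.relabel (Sum.map j id), hψ.relabel, fun M _ _ hM val => ?_⟩
  have h₁ : (ψ.relabel (Sum.map j id)).realize val Fin.elim0 =
      ψ.realize (val ∘ j) Fin.elim0 := ψ.realize_relabel (by rintro (i | i) <;> rfl)
  have h₂ : (φ.relabel (Sum.map g id)).realize (val ∘ j) Fin.elim0 =
      φ.realize val Fin.elim0 := by
    rw [φ.realize_relabel (val := val ∘ j ∘ g) (x := Fin.elim0) (by rintro (i | i) <;> rfl)]
    exact h M _ _ _ fun a ha => congrArg val (hjg a ha)
  rw [h₁, ← h₂]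
  exact hφψ M hM _

end Relabel

/-! ### Extending uniformly continuous maps to completions -/

section Extension

open UniformSpace

variable {X : Type*} [PseudoMetricSpace X] {ι : Type*}

theorem denseRange_piMap_coe :
    DenseRange fun (a : ι → X) i => (a i : Completion X) :=
  DenseRange.piMap fun _ => Completion.denseRange_coe

/-- The modulus survives unchanged because its hypothesis `<` is open and its conclusion `≤` is
closed: a pair satisfying the hypothesis is a limit of pairs from the dense set that satisfy it too.
-/
theorem exists_extend_pi_completion [Fintype ι] {Y : Type*} [MetricSpace Y] [CompleteSpace Y]
    (g : (ι → X) → Y) {δ : ℝ → ℝ} (hδ : ∀ ε, 0 < ε → 0 < δ ε)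
    (hg : ∀ ε, 0 < ε → ∀ a b, dist a b < δ ε → dist (g a) (g b) ≤ ε) :
    ∃ G : (ι → Completion X) → Y, Continuous G ∧
      (∀ a : ι → X, G (fun i => (a i : Completion X)) = g a) ∧
      ∀ ε, 0 < ε → ∀ a b, dist a b < δ ε → dist (G a) (G b) ≤ ε := by
  have hiso : Isometry fun (a : ι → X) i => (a i : Completion X) :=
    Isometry.piMap _ fun _ => Completion.coe_isometry
  have hd := denseRange_piMap_coe (X := X) (ι := ι)
  have hu : UniformContinuous g := continuous_of_modulus hδ hg
  set G := (hiso.isUniformInducing.isDenseInducing hd).extend g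
  have hG : Continuous G :=
    (uniformContinuous_uniformly_extend hiso.isUniformInducing hd hu).continuous
  have hGg : ∀ a : ι → X, G (fun i => (a i : Completion X)) = g a :=
    uniformly_extend_of_ind hiso.isUniformInducing hd hu
  refine ⟨G, hG, hGg, fun ε hε a b hab => ?_⟩
  have hopen : IsOpen {p : (ι → Completion X) × (ι → Completion X) | dist p.1 p.2 < δ ε} :=
    isOpen_lt (by fun_prop) continuous_const
  have hclosed : IsClosed {p : (ι → Completion X) × (ι → Completion X) |
      dist (G p.1) (G p.2) ≤ ε} := isClosed_le (by fun_prop) continuous_const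
  have hmem := (hd.prodMap hd).open_subset_closure_inter hopen (show (a, b) ∈ _ from hab)
  refine hclosed.closure_subset_iff.2 ?_ hmem
  rintro _ ⟨hp, ⟨c, d⟩, rfl⟩
  simp only [Prod.map_apply, Set.mem_ofPred_eq] at hp ⊢
  rw [hGg, hGg]
  exact hg ε hε c d (by rwa [← hiso.dist_eq])

end Extension

/-! ### Ultralimits of bounded families -/

section UltrafilterLimit

variable {I : Type*}

theorem tendsto_limUnder_of_mem_Icc (U : Ultrafilter I) {g : I → ℝ} {a b : ℝ}
    (hg : ∀ i, g i ∈ Set.Icc a b) : Tendsto g U (𝓝 (limUnder (U : Filter I) g)) := by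
  obtain ⟨x, -, hx⟩ := isCompact_Icc.ultrafilter_le_nhds (U.map g)
    (le_principal_iff.2 (Filter.mem_map.2 (Filter.univ_mem' hg)))
  exact tendsto_nhds_limUnder ⟨x, hx⟩

end UltrafilterLimit

/-! ### The term model and the quantifier-free Łoś theorem -/

section TermModel

variable {M : Type w} [MetricSpace M] [MetricStructure L M] {I : Type*} {α : Type w'}

/-- The `L`-terms over `α`, regarded as elements of the ultrapower of `M` along `U` in which the
variable `x` denotes the class of the family `i ↦ val i x`. -/
@[nolint unusedArguments]
def UltraTerm (_ : Ultrafilter I) (_ : I → α → M) (L : Signature.{u, v}) [MetricStructure L M] :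
    Type (max u w') := Term L α

variable (U : Ultrafilter I) (val : I → α → M)

namespace UltraTerm

/-- The coordinates of an element of the ultrapower that is given by a term. -/
def coord {U : Ultrafilter I} {val : I → α → M} (t : UltraTerm U val L) (i : I) : M :=
  Term.realize (val i) t

/-- A variable as an element of the ultrapower. -/
def var (x : α) : UltraTerm U val L := Term.var x

/-- The value of a term at elements of the ultrapower. -/
def subst {U : Ultrafilter I} {val : I → α → M} {β : Type*} (t : Term L β)
    (v : β → UltraTerm U val L) : UltraTerm U val L :=
  Term.subst v t

theorem coord_subst {β : Type*} (t : Term L β) (v : β → UltraTerm U val L) (i : I) :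
    (subst t v).coord i = t.realize fun b => (v b).coord i :=
  Term.realize_subst v (val i) t

theorem dist_coord_mem (t s : UltraTerm U val L) (i : I) :
    dist (t.coord i) (s.coord i) ∈ Set.Icc 0 L.diam :=
  ⟨dist_nonneg, MetricStructure.dist_le_diam _ _⟩

noncomputable instance : Dist (UltraTerm U val L) where
  dist t s := limUnder (U : Filter I) fun i => dist (t.coord i) (s.coord i)

theorem tendsto_dist (t s : UltraTerm U val L) :
    Tendsto (fun i => dist (t.coord i) (s.coord i)) U (𝓝 (dist t s)) :=
  tendsto_limUnder_of_mem_Icc U (dist_coord_mem U val t s)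

noncomputable instance : PseudoMetricSpace (UltraTerm U val L) where
  dist_self t := tendsto_nhds_unique (tendsto_dist U val t t) (by simp)
  dist_comm t s := tendsto_nhds_unique (tendsto_dist U val t s)
    (by simpa only [dist_comm] using tendsto_dist U val s t)
  dist_triangle t s r := le_of_tendsto_of_tendsto' (tendsto_dist U val t r)
    ((tendsto_dist U val t s).add (tendsto_dist U val s r)) fun _ => dist_triangle _ _ _

/-- A strict bound on a limit holds at almost all indices, and finitely many coordinates can be
treated at once. This matches the strict hypothesis in the moduli. -/
theorem eventually_dist_coord_lt {k : ℕ} {ts ss : Fin k → UltraTerm U val L} {δ : ℝ}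
    (h : dist ts ss < δ) :
    ∀ᶠ i in (U : Filter I), dist (fun j => (ts j).coord i) (fun j => (ss j).coord i) < δ := by
  have hδ : 0 < δ := dist_nonneg.trans_lt h
  have : ∀ j, ∀ᶠ i in (U : Filter I), dist ((ts j).coord i) ((ss j).coord i) < δ := fun j =>
    (tendsto_dist U val _ _).eventually_lt_const ((dist_pi_lt_iff hδ).1 h j)
  filter_upwards [eventually_all.2 this] with i hi
  exact (dist_pi_lt_iff hδ).2 hi

/-- The interpretation of a function symbol on terms. -/
def func {k : ℕ} (f : L.Func k) (ts : Fin k → UltraTerm U val L) : UltraTerm U val L :=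
  Term.func f ts

theorem func_modulus {k : ℕ} (f : L.Func k) (ε : ℝ) (hε : 0 < ε)
    (ts ss : Fin k → UltraTerm U val L) (h : dist ts ss < L.funcModulus f ε) :
    dist (func U val f ts) (func U val f ss) ≤ ε := by
  refine le_of_tendsto (tendsto_dist U val _ _) ?_
  filter_upwards [eventually_dist_coord_lt U val h] with i hi
  exact MetricStructure.funMap_modulus f ε hε _ _ hi

/-- The interpretation of a predicate symbol on terms. -/
noncomputable def rel {k : ℕ} (R : L.Rel k) (ts : Fin k → UltraTerm U val L) : ℝ :=
  limUnder (U : Filter I) fun i => MetricStructure.relMap R fun j => (ts j).coord i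

theorem tendsto_rel {k : ℕ} (R : L.Rel k) (ts : Fin k → UltraTerm U val L) :
    Tendsto (fun i => MetricStructure.relMap R fun j => (ts j).coord i) U
      (𝓝 (rel U val R ts)) :=
  tendsto_limUnder_of_mem_Icc U fun _ => MetricStructure.relMap_mem R _

theorem rel_modulus {k : ℕ} (R : L.Rel k) (ε : ℝ) (hε : 0 < ε)
    (ts ss : Fin k → UltraTerm U val L) (h : dist ts ss < L.relModulus R ε) :
    dist (rel U val R ts) (rel U val R ss) ≤ ε := by
  refine le_of_tendsto ((tendsto_rel U val R ts).dist (tendsto_rel U val R ss)) ?_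
  filter_upwards [eventually_dist_coord_lt U val h] with i hi
  exact MetricStructure.relMap_modulus R ε hε _ _ hi

end UltraTerm

variable (L) in
/-- The closure, in the ultrapower of `M` along `U`, of the set of elements given by terms. -/
abbrev TermModel : Type (max u w') := UniformSpace.Completion (UltraTerm U val L)

namespace TermModel

open UltraTerm UniformSpace

theorem exists_func {k : ℕ} (f : L.Func k) :
    ∃ F : (Fin k → TermModel L U val) → TermModel L U val, Continuous F ∧
      (∀ ts : Fin k → UltraTerm U val L, F (fun j => ts j) = func U val f ts) ∧
      ∀ ε, 0 < ε → ∀ a b, dist a b < L.funcModulus f ε → dist (F a) (F b) ≤ ε :=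
  exists_extend_pi_completion _ (L.funcModulus_pos f) fun ε hε ts ss h => by
    rw [Completion.dist_eq]
    exact func_modulus U val f ε hε ts ss h

theorem exists_rel {k : ℕ} (R : L.Rel k) :
    ∃ P : (Fin k → TermModel L U val) → ℝ, Continuous P ∧
      (∀ ts : Fin k → UltraTerm U val L, P (fun j => ts j) = rel U val R ts) ∧
      ∀ ε, 0 < ε → ∀ a b, dist a b < L.relModulus R ε → dist (P a) (P b) ≤ ε :=
  exists_extend_pi_completion _ (L.relModulus_pos R) (rel_modulus U val R)

noncomputable instance [Nonempty α] : MetricStructure L (TermModel L U val) where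
  complete := inferInstance
  nonempty := ⟨((var U val (Classical.arbitrary α) : UltraTerm U val L) : TermModel L U val)⟩
  dist_le_diam a b := by
    induction a, b using Completion.induction_on₂ with
    | hp => exact isClosed_le (by fun_prop) continuous_const
    | ih t s =>
      rw [Completion.dist_eq]
      exact le_of_tendsto' (tendsto_dist U val t s) fun i => (dist_coord_mem U val t s i).2
  funMap f := (exists_func U val f).choose
  relMap R := (exists_rel U val R).choose
  relMap_mem R a := by
    obtain ⟨hc, hR, -⟩ := (exists_rel U val R).choose_spec
    refine denseRange_piMap_coe.induction_on a (isClosed_Icc.preimage hc) fun ts => ?_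
    rw [hR]
    exact isClosed_Icc.mem_of_tendsto (tendsto_rel U val R ts)
      (Eventually.of_forall fun _ => MetricStructure.relMap_mem R _)
  funMap_modulus f := (exists_func U val f).choose_spec.2.2
  relMap_modulus R := (exists_rel U val R).choose_spec.2.2

variable [Nonempty α]

theorem funMap_coe {k : ℕ} (f : L.Func k) (ts : Fin k → UltraTerm U val L) :
    MetricStructure.funMap f (fun j => (ts j : TermModel L U val)) = (func U val f ts : _) :=
  (exists_func U val f).choose_spec.2.1 ts

theorem relMap_coe {k : ℕ} (R : L.Rel k) (ts : Fin k → UltraTerm U val L) :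
    MetricStructure.relMap R (fun j => (ts j : TermModel L U val)) = rel U val R ts :=
  (exists_rel U val R).choose_spec.2.1 ts

variable {β : Type*}

theorem realize_coe (t : Term L β) (v : β → UltraTerm U val L) :
    t.realize (fun b => (v b : TermModel L U val)) = (subst t v : UltraTerm U val L) := by
  induction t with
  | var x => rfl
  | func f ts ih =>
    simp only [Term.realize, ih]
    exact funMap_coe U val f _

/-- Łoś's theorem for quantifier-free formulas. -/
theorem tendsto_realize {k : ℕ} {φ : Formula L β k} (hφ : φ.IsQF)
    (v : β → UltraTerm U val L) (x : Fin k → UltraTerm U val L) :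
    Tendsto (fun i => φ.realize (fun b => (v b).coord i) fun j => (x j).coord i) U
      (𝓝 (φ.realize (fun b => (v b : TermModel L U val)) fun j => (x j : TermModel L U val))) := by
  have elim_coe : ∀ {k : ℕ} (x : Fin k → UltraTerm U val L),
      Sum.elim (fun b => (v b : TermModel L U val)) (fun j => (x j : TermModel L U val)) =
        fun b => ((Sum.elim v x b : UltraTerm U val L) : TermModel L U val) := by
    intro k x; ext (b | b) <;> rfl
  have elim_coord : ∀ {k : ℕ} (x : Fin k → UltraTerm U val L) (i : I),
      Sum.elim (fun b => (v b).coord i) (fun j => (x j).coord i) =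
        fun b => (Sum.elim v x b : UltraTerm U val L).coord i := by
    intro k x i; ext (b | b) <;> rfl
  induction φ with
  | dist t s =>
    simp only [Formula.realize, elim_coe, elim_coord, realize_coe, Completion.dist_eq,
      ← coord_subst]
    exact tendsto_dist U val _ _
  | rel R ts =>
    simp only [Formula.realize, elim_coe, elim_coord, realize_coe, relMap_coe, ← coord_subst]
    exact tendsto_rel U val R _
  | conn c φ ih =>
    -- Connectives are continuous, hence commute with ultralimits.
    exact ((continuous_subtype_val.comp c.continuous).tendsto _).comp
      (tendsto_pi_nhds.2 fun j => ih j (hφ j) x)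
  | sup φ => exact hφ.elim
  | inf φ => exact hφ.elim

/-- The inequality `φ ≤ 0` is a closed condition, so it suffices to check it on the dense set of
terms, where the value is a limit of values in `M`. -/
theorem realize_sups_eq_zero {k : ℕ} {φ : Formula L Empty k} (hφ : φ.IsQF)
    (hr : φ.range ⊆ Set.Ici 0) (h : φ.sups.realize (M := M) Empty.elim Fin.elim0 = 0) :
    φ.sups.realize (M := TermModel L U val) Empty.elim Fin.elim0 = 0 := by
  rw [Formula.realize_sups_eq_zero_iff hr] at h ⊢
  intro x
  have hc : Continuous fun x : Fin k → TermModel L U val => φ.realize Empty.elim x :=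
    hφ.continuous_realize.comp (Continuous.prodMk_right _)
  refine denseRange_piMap_coe.induction_on x (isClosed_le hc continuous_const) fun ts => ?_
  have := tendsto_realize U val hφ Empty.elim ts
  rw [Subsingleton.elim (fun b : Empty => _) (Empty.elim : Empty → TermModel L U val)] at this
  refine le_of_tendsto' this fun i => ?_
  rw [Subsingleton.elim (fun b : Empty => _) (Empty.elim : Empty → M)]
  exact h _

/-- By `hval` every element of `M` is named by a variable with constant value, so approximate
witnesses in `M` reappear in the term model. -/
theorem realize_infs_eq_zero (hval : ∀ m : M, ∃ a, ∀ i, val i a = m) {k : ℕ}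
    {φ : Formula L Empty k} (hφ : φ.IsQF) (hr : φ.range ⊆ Set.Ici 0)
    (h : φ.infs.realize (M := M) Empty.elim Fin.elim0 = 0) :
    φ.infs.realize (M := TermModel L U val) Empty.elim Fin.elim0 = 0 := by
  rw [Formula.realize_infs_eq_zero_iff hr] at h ⊢
  intro r hr'
  -- Limits preserve only `≤`; halving `r` recovers the strict inequality.
  obtain ⟨x, hx⟩ := h (r / 2) (half_pos hr')
  choose c hc using hval
  let y : Fin k → UltraTerm U val L := fun j => UltraTerm.var U val (c (x j))
  have := tendsto_realize U val hφ Empty.elim y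
  rw [Subsingleton.elim (fun b : Empty => _) (Empty.elim : Empty → TermModel L U val)] at this
  refine ⟨fun j => y j, (le_of_tendsto' this fun i => ?_).trans_lt (half_lt_self hr')⟩
  rw [Subsingleton.elim (fun b : Empty => _) (Empty.elim : Empty → M)]
  have hy : (fun j => (y j).coord i) = x := funext fun j => hc (x j) i
  rw [hy]
  exact hx.le

end TermModel

end TermModel

/-! ### Definable functions in the term model -/

theorem IsPrimitive.models_termModel {T : Theory L} (hT : IsPrimitive.{u, v, w} T)
    {M : Type (max u v w)} [MetricSpace M] [MetricStructure L M] (hM : Models M T)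
    {I : Type*} (U : Ultrafilter I) {α : Type (max u v w)} [Nonempty α] (val : I → α → M)
    (hval : ∀ m : M, ∃ a, ∀ i, val i a = m) : Models (TermModel L U val) T := by
  obtain ⟨Γ, Δ, hΓ, hΔ, hA⟩ := hT
  have hMA := (hA M).2 hM
  -- As `α` lives in the universe of `M`, so does the term model, and the axiomatization applies to
  -- it.
  refine (hA (TermModel L U val)).1 fun σ hσ => ?_
  have hMσ := hMA σ hσ
  rcases hσ with hσ | hσ
  · obtain ⟨k, φ, hφ, hr, rfl⟩ := hΓ σ hσ
    exact TermModel.realize_sups_eq_zero U val hφ hr hMσ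
  · obtain ⟨k, φ, hφ, hr, rfl⟩ := hΔ σ hσ
    exact TermModel.realize_infs_eq_zero U val hval hφ hr hMσ

/-- The renaming of variables that turns the last variable of a formula with parameters into the
variable that is bound by the next quantifier. -/
def bindLast (M : Type*) (n : ℕ) : (M ⊕ Fin (n + 1)) ⊕ Fin 0 → (M ⊕ Fin n) ⊕ Fin 1 :=
  Sum.elim (Sum.elim (fun m => .inl (.inl m)) (Fin.snoc (fun j => .inl (.inr j)) (.inr 0)))
    Fin.elim0

/-- Extends a valuation by a value for one more variable. -/
def extendVal {M N : Type*} {n : ℕ} (v : M ⊕ Fin n → N) (y : N) : M ⊕ Fin (n + 1) → N :=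
  Sum.elim (fun m => v (.inl m)) (Fin.snoc (fun j => v (.inr j)) y)

theorem comp_extendVal {M N N' : Type*} {n : ℕ} (g : N → N') (v : M ⊕ Fin n → N) (y : N) :
    (fun b => g (extendVal v y b)) = extendVal (fun b => g (v b)) (g y) := by
  ext (m | j)
  · rfl
  · induction j using Fin.lastCases <;> simp [extendVal]

theorem continuous_extendVal {M N : Type*} [TopologicalSpace N] {n : ℕ} (v : M ⊕ Fin n → N) :
    Continuous (extendVal v) := by
  refine continuous_pi ?_
  rintro (m | j)
  · exact continuous_const
  · induction j using Fin.lastCases with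
    | last => simpa [extendVal] using continuous_id'
    | cast j => simpa [extendVal] using continuous_const

theorem Formula.realize_bindLast {M : Type*} {N : Type*} [MetricSpace N] [MetricStructure L N]
    {n : ℕ} (φ : FormulaWithParams L M (n + 1)) (v : M ⊕ Fin n → N) (y : N) :
    (φ.relabel (bindLast M n)).realize v (Fin.snoc Fin.elim0 y : Fin 1 → N) =
      φ.realize (extendVal v y) Fin.elim0 := by
  refine φ.realize_relabel ?_
  rintro ((m | j) | j)
  · rfl
  · induction j using Fin.lastCases with
    | last => simp [bindLast, extendVal, Fin.snoc]
    | cast j => simp [bindLast, extendVal]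
  · exact j.elim0

/-- A compactness principle: in an ultrafilter finer than `atTop` on finite sets, almost every `F`
contains a given `i`. -/
theorem exists_ultrafilter_forall_eventually {ι X : Type*} [Nonempty X] {S : ι → X → Prop}
    (h : ∀ F : Finset ι, ∃ a, ∀ i ∈ F, S i a) :
    ∃ (U : Ultrafilter (Finset ι)) (a : Finset ι → X), ∀ i, ∀ᶠ F in (U : Filter (Finset ι)),
      S i (a F) := by
  classical
  choose a ha using h
  refine ⟨Ultrafilter.of atTop, a, fun i => Ultrafilter.of_le atTop ?_⟩
  filter_upwards [eventually_ge_atTop {i}] with F hF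
  exact ha F i (Finset.singleton_subset_iff.1 hF)

/-- In the term model given by a family of tuples, every definable function is approximated by a
term along the ultrafilter. -/
theorem DefinableFunction.exists_term {T : Theory L} (hprim : IsPrimitive.{u, v, w} T)
    (hqe : HasQE.{u, v, w} T) {M : Type (max u v w)} [MetricSpace M] [MetricStructure L M]
    (hM : Models M T) {n : ℕ} {f : (Fin n → M) → M} (hf : DefinableFunction L f)
    {I : Type*} (U : Ultrafilter I) (a : I → Fin n → M) {ε : ℝ} (hε : 0 < ε) :
    ∃ t : TermWithParams L M n, ∀ᶠ i in (U : Filter I), dist (f (a i)) (t.eval (a i)) ≤ ε := by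
  have : Nonempty M := MetricStructure.nonempty L
  -- Error budget: `θ < 2δ` in `M`, so `χ ≤ 3δ` in `M` and in `N`, so `θ < 5δ` in `N`; a witness has
  -- `φ < 5δ` and `ψ < 6δ`. Back in `M`, `φ < 7δ`, and the distance is below `8δ = ε`.
  obtain ⟨δ, hδ, hδε⟩ : ∃ δ : ℝ, 0 < δ ∧ 8 * δ = ε := ⟨ε / 8, by positivity, by ring⟩
  obtain ⟨φ, hφ⟩ := hf δ hδ
  have hφf : ∀ (b : Fin n → M) (y : M),
      |φ.realize (extendVal (Sum.elim id b) y) Fin.elim0 - dist (f b) y| ≤ δ := by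
    intro b y
    have := hφ (Fin.snoc b y)
    simp only [Fin.snoc_castSucc, Fin.snoc_last] at this
    exact this
  obtain ⟨ψ, hψ, hφψ⟩ := hqe.exists_isQF φ hδ
  let θ : FormulaWithParams L M n := (φ.relabel (bindLast M n)).inf
  obtain ⟨χ, hχ, hθχ⟩ := hqe.exists_isQF θ hδ
  have hθM : ∀ b : Fin n → M, θ.realize (Sum.elim id b) Fin.elim0 < 2 * δ := by
    intro b
    refine (Formula.realize_inf_lt_iff _ _ _ _).2 ⟨f b, ?_⟩
    rw [Formula.realize_bindLast]
    have := abs_le.1 (hφf b (f b))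
    rw [dist_self] at this
    linarith
  let val : I → M ⊕ Fin n → M := fun i => Sum.elim id (a i)
  let N := TermModel L U val
  have hN : Models N T := hprim.models_termModel hM U val fun m => ⟨.inl m, fun i => rfl⟩
  let x : M ⊕ Fin n → UltraTerm U val L := UltraTerm.var U val
  let x' : M ⊕ Fin n → N := fun b => x b
  have hχN : χ.realize x' Fin.elim0 ≤ 3 * δ := by
    have hlim := TermModel.tendsto_realize U val hχ x Fin.elim0
    rw [Subsingleton.elim (fun j : Fin 0 => _) (Fin.elim0 : Fin 0 → N)] at hlim
    refine le_of_tendsto' hlim fun i => ?_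
    rw [Subsingleton.elim (fun j : Fin 0 => _) (Fin.elim0 : Fin 0 → M)]
    have h₁ := abs_le.1 (hθχ M hM (val i))
    have h₂ := hθM (a i)
    change χ.realize (val i) _ ≤ _
    linarith
  have hθN : θ.realize x' Fin.elim0 < 5 * δ := by
    have := abs_le.1 (hθχ N hN x')
    linarith
  obtain ⟨y, hy⟩ := (Formula.realize_inf_lt_iff _ _ _ _).1 hθN
  rw [Formula.realize_bindLast] at hy
  have hyψ : ψ.realize (extendVal x' y) Fin.elim0 < 6 * δ := by
    have := abs_le.1 (hφψ N hN (extendVal x' y))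
    linarith
  have hopen : IsOpen {y : N | ψ.realize (extendVal x' y) Fin.elim0 < 6 * δ} :=
    isOpen_lt (hψ.continuous_realize.comp
      ((continuous_extendVal x').prodMk continuous_const)) continuous_const
  -- The witness `y` is only a limit of terms. Since `ψ` is continuous, the strict bound holds near
  -- `y`, hence at some actual term.
  obtain ⟨t, ht⟩ := UniformSpace.Completion.denseRange_coe.exists_mem_open hopen ⟨y, hyψ⟩
  refine ⟨t, ?_⟩
  have hlim := TermModel.tendsto_realize U val hψ (extendVal x t) Fin.elim0
  rw [Subsingleton.elim (fun j : Fin 0 => _) (Fin.elim0 : Fin 0 → N),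
    comp_extendVal (fun s : UltraTerm U val L => (s : N))] at hlim
  filter_upwards [hlim.eventually_lt_const ht] with i hi
  rw [Subsingleton.elim (fun j : Fin 0 => _) (Fin.elim0 : Fin 0 → M),
    comp_extendVal (fun s : UltraTerm U val L => s.coord i)] at hi
  change ψ.realize (extendVal (val i) (t.coord i)) Fin.elim0 < _ at hi
  have h₁ := abs_le.1 (hφψ M hM (extendVal (val i) (t.coord i)))
  have h₂ := abs_le.1 (hφf (a i) (t.coord i))
  change dist (f (a i)) (t.coord i) ≤ ε
  linarith

end ContinuousLogic

theorem proposition3p3 {L : ContinuousLogic.Signature.{u, v}} {T : ContinuousLogic.Theory L}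
    (hprim : ContinuousLogic.IsPrimitive.{u, v, w} T)
    (hqe : ContinuousLogic.HasQE.{u, v, w} T)
    (M : Type (max u v w)) [MetricSpace M] [ContinuousLogic.MetricStructure L M]
    (hM : ContinuousLogic.Models M T)
    (n : ℕ) (f : (Fin n → M) → M) (hf : ContinuousLogic.DefinableFunction L f)
    (ε : ℝ) (hε : 0 < ε) :
    ∃ (k : ℕ) (t : Fin k → ContinuousLogic.TermWithParams L M n),
      ∀ a : Fin n → M, ∃ i : Fin k,
        dist (f a) (ContinuousLogic.TermWithParams.eval (t i) a) ≤ ε := by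
  classical
  have : Nonempty M := ContinuousLogic.MetricStructure.nonempty L
  by_contra! h
  -- The finite sets of terms serve as the index set; each is enumerated by its cardinality to
  -- contradict the negated conclusion.
  obtain ⟨U, a, ha⟩ := ContinuousLogic.exists_ultrafilter_forall_eventually
    (ι := ContinuousLogic.TermWithParams L M n)
    (S := fun t (b : Fin n → M) => ε < dist (f b) (t.eval b)) fun F => by
      obtain ⟨b, hb⟩ := h F.card fun i => F.equivFin.symm i
      exact ⟨b, fun t ht => by simpa using hb (F.equivFin ⟨t, ht⟩)⟩
  obtain ⟨t, ht⟩ := hf.exists_term hprim hqe hM U a hε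
  obtain ⟨F, hF, hF'⟩ := (ht.and (ha t)).exists
  exact hF.not_gt hF'
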